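/- Let $(\mathcal S,\mathcal A,P,\rho,\gamma)$ be a Markov decision process with finite state space $\mathcal S$, finite nonempty action space $\mathcal A$, transition kernel $P:\mathcal S\times\mathcal A\to\Delta(\mathcal S)$, initial distribution $\rho\in\Delta(\mathcal S)$ and discount factor $\gamma\in(0,1)$. A policy is a map $\pi:\mathcal S\to\Delta(\mathcal A)$. For $r:\mathcal S\times\mathcal A\to\mathbb R$ write $\|r\|_\infty=\max_{s,a}|r(s,a)|$ and $$V^\pi_r(s)=\mathbb E\Big[\sum_{t\ge0}\gamma^t r(s_t,a_t)\,\Big|\,s_0=s,\pi\Big],\qquad V^\pi_r(\rho)=\sum_s\rho(s)V^\pi_r(s).$$ Let $d^\pi_\rho(s,a)=(1-\gamma)\,\mathbb E_{s_0\sim\rho}\sum_{t\ge0}\gamma^t\,\mathbb P(s_t=s,a_t=a\mid s_0,\pi)$ and $d^\pi_\rho(s)=\sum_a d^\pi_\rho(s,a)$ be the discounted visitation distributions, and for policies $\pi,\pi'$ and a distribution $d$ on $\mathcal S$ let $D_d(\pi\|\pi')=\sum_s d(s)\sum_a\pi(a|s)\log\frac{\pi(a|s)}{\pi'(a|s)}$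 (with $0\log0=0$). For $\theta\in\mathbb R^{\mathcal S\times\mathcal A}$ let $\pi_\theta(a|s)=\exp(\theta_{s,a})/\sum_{a'}\exp(\theta_{s,a'})$ be the softmax policy, and let $$\mathcal F_\rho(\theta)=\mathbb E_{(s,a)\sim d^{\pi_\theta}_\rho}\big[\nabla_\theta\log\pi_\theta(a|s)\,(\nabla_\theta\log\pi_\theta(a|s))^\top\big]$$ be the Fisher information matrix, with Moore–Penrose inverse $\mathcal F_\rho(\theta)^\dagger$. Let $\tilde r_k:\mathcal S\times\mathcal A\to\mathbb R$ be any reward function, $\theta_k\in\mathbb R^{\mathcal S\times\mathcal A}$ any parameter, $\pi_k=\pi_{\theta_k}$, $\alpha>0$, $\eta=\frac{1-\gamma}{\alpha}$, $\epsilon_k>0$, and let $$\tilde V_{k,\alpha}(\theta)=V^{\pi_\theta}_{\tilde r_k}(\rho)-\alpha\,\frac{D_{d^{\pi_\theta}_\rho}(\pi_\theta\|\pi_k)}{1-\gamma}$$ be the KL-regularized value anchored at $\pi_k$. InnerLoop starts at $\theta_k^{(0)}=\theta_k$ and performs $t_k$ natural policy gradient steps with exact gradients $$\theta_k^{(t+1)}=\theta_k^{(t)}+\eta\,\mathcal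 F_\rho(\theta_k^{(t)})^\dagger\,\nabla_\theta\tilde V_{k,\alpha}(\theta_k^{(t)}),\qquad t=0,\dots,t_k-1;$$ let $\pi_{k+1}=\pi_{\theta_k^{(t_k)}}$. Suppose that the integer $t_k\ge0$ satisfies $$t_k\ge\frac1{1-\gamma}\log\Big(\frac{5\|\tilde r_k\|_\infty}{(1-\gamma)^2\epsilon_k}\Big)+1$$ (no condition if $\tilde r_k=0$, where $\log 0=-\infty$). Then for every policy $\pi$ (not only softmax policies) $$V^{\pi_{k+1}}_{\tilde r_k}(\rho)-\alpha\,\frac{D_{d^{\pi_{k+1}}_\rho}(\pi_{k+1}\|\pi_k)}{1-\gamma}\;\ge\;V^{\pi}_{\tilde r_k}(\rho)-\alpha\,\frac{D_{d^{\pi}_\rho}(\pi\|\pi_k)-D_{d^{\pi}_\rho}(\pi\|\pi_{k+1})}{1-\gamma}-\epsilon_k .$$ -/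

import Mathlib

noncomputable section

/-! ### Moore-Penrose inverse of a real matrix -/

/-- The four Penrose conditions: `X` is a Moore-Penrose inverse of the real matrix `A`. -/
structure IsMoorePenrose {m n : Type*} [Fintype m] [Fintype n]
    (A : Matrix m n ℝ) (X : Matrix n m ℝ) : Prop where
  mul_mul_self : A * X * A = A
  mul_mul_inv : X * A * X = X
  symm_left : (A * X).transpose = A * X
  symm_right : (X * A).transpose = X * A

theorem IsMoorePenrose.unique {m n : Type*} [Fintype m] [Fintype n]
    {A : Matrix m n ℝ} {X Y : Matrix n m ℝ}
    (hX : IsMoorePenrose A X) (hY : IsMoorePenrose A Y) : X = Y := by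
  have h1 : A * X = A * Y := by
    calc A * X = (A * X).transpose := hX.symm_left.symm
      _ = ((A * Y) * (A * X)).transpose := by
          rw [← Matrix.mul_assoc, hY.mul_mul_self]
      _ = (A * X).transpose * (A * Y).transpose := Matrix.transpose_mul _ _
      _ = (A * X) * (A * Y) := by rw [hX.symm_left, hY.symm_left]
      _ = A * Y := by rw [← Matrix.mul_assoc, hX.mul_mul_self]
  have h2 : X * A = Y * A := by
    calc X * A = (X * A).transpose := hX.symm_right.symm
      _ = ((X * A) * (Y * A)).transpose := by
          rw [Matrix.mul_assoc, ← Matrix.mul_assoc A Y A, hY.mul_mul_self]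
      _ = (Y * A).transpose * (X * A).transpose := Matrix.transpose_mul _ _
      _ = (Y * A) * (X * A) := by rw [hX.symm_right, hY.symm_right]
      _ = Y * A := by rw [Matrix.mul_assoc, ← Matrix.mul_assoc A X A, hX.mul_mul_self]
  calc X = X * A * X := hX.mul_mul_inv.symm
    _ = Y * (A * X) := by rw [h2, Matrix.mul_assoc]
    _ = Y * A * Y := by rw [h1, Matrix.mul_assoc]
    _ = Y := hY.mul_mul_inv

theorem exists_symm_isMoorePenrose_of_isHermitian {n : Type*} [Fintype n]
    (A : Matrix n n ℝ) (hA : A.IsHermitian) :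
    ∃ X : Matrix n n ℝ, IsMoorePenrose A X ∧ X.transpose = X := by
  classical
  have hS := hA.spectral_theorem
  rw [Unitary.conjStarAlgAut_apply] at hS
  generalize (hA.eigenvectorUnitary : Matrix.unitaryGroup n ℝ) = U at hS
  generalize hd : (RCLike.ofReal ∘ hA.eigenvalues : n → ℝ) = d at hS
  have hU : star (U : Matrix n n ℝ) * (U : Matrix n n ℝ) = 1 := Unitary.coe_star_mul_self U
  have hst : star (U : Matrix n n ℝ) = (U : Matrix n n ℝ).transpose := by
    ext i j; simp [Matrix.star_apply]
  rw [hst] at hS hU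
  generalize (U : Matrix n n ℝ) = V at hS hU
  have hmul : ∀ B C : Matrix n n ℝ,
      (V * B * V.transpose) * (V * C * V.transpose) = V * (B * C) * V.transpose := by
    intro B C
    calc (V * B * V.transpose) * (V * C * V.transpose)
        = V * B * (V.transpose * V) * C * V.transpose := by simp only [Matrix.mul_assoc]
      _ = V * (B * C) * V.transpose := by rw [hU]; simp only [Matrix.mul_assoc, Matrix.one_mul]
  have htr : ∀ e : n → ℝ, (V * Matrix.diagonal e * V.transpose).transpose
      = V * Matrix.diagonal e * V.transpose := by
    intro e
    simp only [Matrix.transpose_mul, Matrix.transpose_transpose, Matrix.diagonal_transpose,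
      Matrix.mul_assoc]
  refine ⟨V * Matrix.diagonal (fun i => (d i)⁻¹) * V.transpose, ⟨?_, ?_, ?_, ?_⟩, htr _⟩
  · rw [hS, hmul, hmul]
    simp only [Matrix.diagonal_mul_diagonal, mul_inv_mul_cancel]
  · rw [hS, hmul, hmul]
    have h : ∀ x : ℝ, x⁻¹ * x * x⁻¹ = x⁻¹ := fun x => by
      simpa using mul_inv_mul_cancel x⁻¹
    simp only [Matrix.diagonal_mul_diagonal, h]
  · rw [hS, hmul, Matrix.diagonal_mul_diagonal]; exact htr _
  · rw [hS, hmul, Matrix.diagonal_mul_diagonal]; exact htr _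

theorem exists_isMoorePenrose {m n : Type*} [Fintype m] [Fintype n] (A : Matrix m n ℝ) :
    ∃ X : Matrix n m ℝ, IsMoorePenrose A X := by
  have hH : (A.transpose * A).IsHermitian := by
    simpa [Matrix.conjTranspose_eq_transpose_of_trivial] using
      Matrix.isHermitian_conjTranspose_mul_self A
  obtain ⟨B, hB, hBt⟩ := exists_symm_isMoorePenrose_of_isHermitian _ hH
  refine ⟨B * A.transpose, ?_, ?_, ?_, ?_⟩
  · have h0 : A.transpose * (A * (B * A.transpose) * A - A) = 0 := by
      rw [Matrix.mul_sub, sub_eq_zero]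
      simpa only [Matrix.mul_assoc] using hB.mul_mul_self
    have h1 : (A * (B * A.transpose) * A - A).transpose
        * (A * (B * A.transpose) * A - A) = 0 := by
      have : A * (B * A.transpose) * A - A
          = A * (B * A.transpose * A) - A := by simp only [Matrix.mul_assoc]
      have h2 : (A * (B * A.transpose) * A - A).transpose
          = (B * A.transpose * A).transpose * A.transpose - A.transpose := by
        rw [this, Matrix.transpose_sub, Matrix.transpose_mul]
      rw [h2, Matrix.sub_mul, Matrix.mul_assoc, h0]
      simp
    rw [← Matrix.conjTranspose_eq_transpose_of_trivial] at h1
    exact sub_eq_zero.mp (Matrix.conjTranspose_mul_self_eq_zero.mp h1)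
  · have := congrArg (· * A.transpose) hB.mul_mul_inv
    simpa only [Matrix.mul_assoc] using this
  · simp only [Matrix.transpose_mul, Matrix.transpose_transpose, hBt, Matrix.mul_assoc]
  · have := hB.symm_right
    simpa only [Matrix.mul_assoc] using this

/-- The Moore-Penrose inverse of a real matrix: the unique solution of the Penrose conditions. -/
def pinv {m n : Type*} [Fintype m] [Fintype n] (A : Matrix m n ℝ) : Matrix n m ℝ :=
  Classical.choose (exists_isMoorePenrose A)

theorem pinv_spec {m n : Type*} [Fintype m] [Fintype n] (A : Matrix m n ℝ) :
    IsMoorePenrose A (pinv A) :=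
  Classical.choose_spec (exists_isMoorePenrose A)

/-! ### Markov decision processes and softmax policies -/

/-- A finite discounted Markov decision process without its reward function, which is supplied
separately: transition kernel, initial state distribution and discount factor in `(0, 1)`. -/
structure FiniteMDP (S A : Type*) [Fintype S] [Fintype A] where
  P : S → A → stdSimplex ℝ S
  ρ : stdSimplex ℝ S
  γ : ℝ
  γ_pos : 0 < γ
  γ_lt_one : γ < 1

/-- Stationary policies: every state is assigned a probability vector on the actions. -/
abbrev Policy (S A : Type*) [Fintype A] := S → stdSimplex ℝ A

/-- Softmax parameters: vectors indexed by state-action pairs, with the Euclidean structure. -/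
abbrev Param (S A : Type*) := EuclideanSpace ℝ (S × A)

/-- The softmax policy `π_θ(a|s) = exp θ_{s,a} / ∑_{a'} exp θ_{s,a'}`. -/
def softmax {S A : Type*} [Fintype A] [Nonempty A] (θ : Param S A) : Policy S A := fun s =>
  ⟨fun a => Real.exp (θ (s, a)) / ∑ a', Real.exp (θ (s, a')),
    fun a => div_nonneg (Real.exp_pos _).le (Finset.sum_nonneg fun _ _ => (Real.exp_pos _).le),
    by
      rw [← Finset.sum_div]
      exact div_self (Finset.sum_pos (fun _ _ => Real.exp_pos _) Finset.univ_nonempty).ne'⟩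

/-- `D(x || y) = ∑ i, x_i log (x_i / y_i)`, with `0 log 0 = 0`.  (In all uses below the second
argument is a softmax policy at some state, hence has positive entries.) -/
def klVec {ι : Type*} [Fintype ι] (x y : stdSimplex ℝ ι) : ℝ :=
  ∑ i, x i * Real.log (x i / y i)

/-- `D_d(π || π') = ∑ s, d(s) D(π(·|s) || π'(·|s))`. -/
def klPolicy {S A : Type*} [Fintype S] [Fintype A] (d : S → ℝ) (π π' : Policy S A) : ℝ :=
  ∑ s, d s * klVec (π s) (π' s)

namespace FiniteMDP

variable {S A : Type*} [Fintype S] [DecidableEq S] [Fintype A]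

/-- `ℙ(s_t = s | s_0, π)`: the law at time `t` of the state chain started at `s₀`. -/
def stateProb (M : FiniteMDP S A) (π : Policy S A) (s₀ : S) : ℕ → S → ℝ
  | 0, s => if s = s₀ then 1 else 0
  | t + 1, s => ∑ s', ∑ a', stateProb M π s₀ t s' * π s' a' * M.P s' a' s

/-- `ℙ(s_t = s, a_t = a | s_0, π)`. -/
def stateActionProb (M : FiniteMDP S A) (π : Policy S A) (s₀ : S) (t : ℕ) (s : S) (a : A) : ℝ :=
  M.stateProb π s₀ t s * π s a

/-- The state value `V^π_r(s₀) = ∑_t γ^t 𝔼[r(s_t, a_t) | s_0, π]`. -/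
def stateValue (M : FiniteMDP S A) (r : S × A → ℝ) (π : Policy S A) (s₀ : S) : ℝ :=
  ∑' t : ℕ, M.γ ^ t * ∑ s, ∑ a, M.stateActionProb π s₀ t s a * r (s, a)

/-- `V^π_r(ρ) = 𝔼_{s ∼ ρ} V^π_r(s)`. -/
def value (M : FiniteMDP S A) (r : S × A → ℝ) (π : Policy S A) : ℝ :=
  ∑ s, M.ρ s * M.stateValue r π s

/-- The discounted state visitation distribution `d^π_ρ(s)`. -/
def stateVisit (M : FiniteMDP S A) (π : Policy S A) (s : S) : ℝ :=
  ∑ s₀, M.ρ s₀ * ((1 - M.γ) * ∑' t : ℕ, M.γ ^ t * M.stateProb π s₀ t s)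

/-- The discounted state-action visitation distribution `d^π_ρ(s, a)`. -/
def stateActionVisit (M : FiniteMDP S A) (π : Policy S A) (s : S) (a : A) : ℝ :=
  (1 - M.γ) * ∑ s₀, M.ρ s₀ * ∑' t : ℕ, M.γ ^ t * M.stateActionProb π s₀ t s a

variable [Nonempty A]

/-- The KL-regularized value with anchor policy `π_{θ₀}`, as a function of the parameter `θ`:
`V^{π_θ}_r(ρ) - α D_{d^{π_θ}_ρ}(π_θ || π_{θ₀}) / (1 - γ)`. -/
def regValue (M : FiniteMDP S A) (r : S × A → ℝ) (α : ℝ) (θ₀ θ : Param S A) : ℝ :=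
  M.value r (softmax θ)
    - α * (klPolicy (M.stateVisit (softmax θ)) (softmax θ) (softmax θ₀) / (1 - M.γ))

/-- The score `∇_θ log π_θ(a|s)`. -/
def score (θ : Param S A) (s : S) (a : A) : Param S A :=
  gradient (fun θ' : Param S A => Real.log (softmax θ' s a)) θ

/-- The Fisher information matrix
`𝔼_{(s,a) ∼ d^{π_θ}_ρ} [∇_θ log π_θ(a|s) (∇_θ log π_θ(a|s))ᵀ]`. -/
def fisher (M : FiniteMDP S A) (θ : Param S A) : Matrix (S × A) (S × A) ℝ :=
  ∑ s, ∑ a, M.stateActionVisit (softmax θ) s a •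
    Matrix.vecMulVec (score θ s a).ofLp (score θ s a).ofLp

/-- One natural policy gradient step on the KL-regularized value:
`θ ↦ θ + η F_ρ(θ)^† ∇_θ (regularized value)(θ)`. -/
def npgStep (M : FiniteMDP S A) (r : S × A → ℝ) (α η : ℝ) (θ₀ θ : Param S A) : Param S A :=
  θ + η • WithLp.toLp 2
    ((pinv (M.fisher θ)).mulVec (gradient (M.regValue r α θ₀) θ).ofLp)

/-- InnerLoop: `t` natural policy gradient steps, started at the anchor parameter `θ₀`. -/
def innerLoop (M : FiniteMDP S A) (r : S × A → ℝ) (α η : ℝ) (θ₀ : Param S A) (t : ℕ) :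
    Param S A :=
  (M.npgStep r α η θ₀)^[t] θ₀

end FiniteMDP

end

/-! With `η = (1 - γ) / α`, one natural gradient step is one step of KL-regularized soft policy
iteration: at every reachable state the new policy is proportional to `π₀ exp (Q / α)`, where `Q` is
the lookahead of the regularized value of the current policy. Indeed the gradient is `F w`, with `F`
the Fisher matrix and `w` the regularized advantage over `1 - γ`, up to a function of the state.
Then `F† F w - w` lies in the kernel of `F`, whose vectors are constant in the action at reachable
states, and softmax ignores such shifts (`isSoftGreedy_npgStep`).

Write `T_σ` for the regularized Bellman operator, `V_n` for the regularized value of the `n`-th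
policy `p n`. The Gibbs identity gives, for every policy `σ`, the equality `T_σ V_n + α KL(σ ‖ p
(n+1)) = T_{p (n+1)} V_n`. Hence `V_n` increases with `n`, and every `σ` satisfies `V_σ ≤ V_n + γ^n
· 2‖r‖ / (1 - γ)` (`regStateValue_le_add_pow`).

Inserting the same equality into the performance difference lemma around `V_{n+1}` retains the term
`KL(σ ‖ p (n+1))`, with error `γ / (1 - γ)` times a bound on `V_{n+1} - V_n`
(`IsSoftGreedy.regPolicyValue_add_le`). The step count makes this error at most `ε`. All comparisons
are made at reachable states only, because the Fisher matrix carries no information about the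
others. -/

noncomputable section

/-! ### Discounted state chain: Green function, visitation, reachability. -/

namespace FiniteMDP

variable {S A : Type*} [Fintype S] [Fintype A]

/-- One-step transition probabilities of the state chain under `π`. -/
def trans (M : FiniteMDP S A) (π : Policy S A) (s s' : S) : ℝ :=
  ∑ a, π s a * M.P s a s'

theorem one_sub_γ_pos (M : FiniteMDP S A) : 0 < 1 - M.γ := sub_pos.2 M.γ_lt_one

theorem trans_nonneg (M : FiniteMDP S A) (π : Policy S A) (s s' : S) : 0 ≤ M.trans π s s' :=
  Finset.sum_nonneg fun a _ => mul_nonneg ((π s).2.1 a) ((M.P s a).2.1 s')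

theorem sum_P (M : FiniteMDP S A) (s : S) (a : A) : ∑ s', M.P s a s' = 1 := (M.P s a).2.2

theorem sum_trans (M : FiniteMDP S A) (π : Policy S A) (s : S) : ∑ s', M.trans π s s' = 1 := by
  simp only [trans]
  rw [Finset.sum_comm]
  simp only [← Finset.mul_sum, M.sum_P, mul_one]
  exact (π s).2.2

theorem summable_γ_pow (M : FiniteMDP S A) : Summable fun t : ℕ => M.γ ^ t :=
  summable_geometric_of_lt_one M.γ_pos.le M.γ_lt_one

/-- States that can be reached with positive probability under some choice of actions. -/
inductive Reachable (M : FiniteMDP S A) : S → Prop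
  | init {s : S} : 0 < M.ρ s → Reachable M s
  | step {s : S} (a : A) {s' : S} : Reachable M s → 0 < M.P s a s' → Reachable M s'

theorem Reachable.of_trans_ne_zero {M : FiniteMDP S A} {π : Policy S A} {s s' : S}
    (hs : M.Reachable s) (h : M.trans π s s' ≠ 0) : M.Reachable s' := by
  obtain ⟨a, -, ha⟩ := Finset.exists_ne_zero_of_sum_ne_zero h
  exact hs.step a (((M.P s a).2.1 s').lt_of_ne' (right_ne_zero_of_mul ha))

theorem Reachable.sum_trans_mono {M : FiniteMDP S A} (π : Policy S A) {v w : S → ℝ}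
    (h : ∀ s, M.Reachable s → v s ≤ w s) {s : S} (hs : M.Reachable s) :
    ∑ s', M.trans π s s' * v s' ≤ ∑ s', M.trans π s s' * w s' := by
  refine Finset.sum_le_sum fun s' _ => ?_
  by_cases h0 : M.trans π s s' = 0
  · simp [h0]
  · exact mul_le_mul_of_nonneg_left (h s' (hs.of_trans_ne_zero h0)) (M.trans_nonneg π s s')

variable [DecidableEq S]

/-- The Green function `∑_t γ^t ℙ(s_t = s | s₀)` of the state chain under `π`. -/
def green (M : FiniteMDP S A) (π : Policy S A) (s₀ s : S) : ℝ :=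
  ∑' t : ℕ, M.γ ^ t * M.stateProb π s₀ t s

theorem stateProb_succ (M : FiniteMDP S A) (π : Policy S A) (s₀ : S) (t : ℕ) (s : S) :
    M.stateProb π s₀ (t + 1) s = ∑ s', M.stateProb π s₀ t s' * M.trans π s' s := by
  simp only [stateProb, trans, Finset.mul_sum, mul_assoc]

theorem stateProb_succ' (M : FiniteMDP S A) (π : Policy S A) (s₀ : S) (t : ℕ) (s : S) :
    M.stateProb π s₀ (t + 1) s = ∑ s', M.trans π s₀ s' * M.stateProb π s' t s := by
  induction t generalizing s with
  | zero => simp [stateProb, trans]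
  | succ t ih =>
    rw [stateProb_succ]
    simp only [ih, Finset.sum_mul]
    rw [Finset.sum_comm]
    simp only [M.stateProb_succ π _ t s, Finset.mul_sum, mul_assoc]

theorem stateProb_nonneg (M : FiniteMDP S A) (π : Policy S A) (s₀ : S) (t : ℕ) (s : S) :
    0 ≤ M.stateProb π s₀ t s := by
  induction t generalizing s with
  | zero => simp only [stateProb]; split_ifs <;> norm_num
  | succ t ih =>
    rw [stateProb_succ]
    exact Finset.sum_nonneg fun s' _ => mul_nonneg (ih s') (M.trans_nonneg π s' s)

theorem sum_stateProb (M : FiniteMDP S A) (π : Policy S A) (s₀ : S) (t : ℕ) :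
    ∑ s, M.stateProb π s₀ t s = 1 := by
  induction t with
  | zero => simp [stateProb]
  | succ t ih =>
    simp only [stateProb_succ]
    rw [Finset.sum_comm]
    simp only [← Finset.mul_sum, M.sum_trans, mul_one, ih]

theorem stateProb_le_one (M : FiniteMDP S A) (π : Policy S A) (s₀ : S) (t : ℕ) (s : S) :
    M.stateProb π s₀ t s ≤ 1 := by
  rw [← M.sum_stateProb π s₀ t]
  exact Finset.single_le_sum (f := M.stateProb π s₀ t)
    (fun s _ => M.stateProb_nonneg π s₀ t s) (Finset.mem_univ s)

theorem norm_pow_mul_stateProb_le (M : FiniteMDP S A) (π : Policy S A) (s₀ : S) (t : ℕ) (s : S) :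
    ‖M.γ ^ t * M.stateProb π s₀ t s‖ ≤ M.γ ^ t := by
  have h := pow_nonneg M.γ_pos.le t
  rw [Real.norm_of_nonneg (mul_nonneg h (M.stateProb_nonneg π s₀ t s))]
  exact mul_le_of_le_one_right h (M.stateProb_le_one π s₀ t s)

theorem summable_stateProb (M : FiniteMDP S A) (π : Policy S A) (s₀ s : S) :
    Summable fun t : ℕ => M.γ ^ t * M.stateProb π s₀ t s :=
  M.summable_γ_pow.of_norm_bounded fun t => M.norm_pow_mul_stateProb_le π s₀ t s

theorem green_nonneg (M : FiniteMDP S A) (π : Policy S A) (s₀ s : S) : 0 ≤ M.green π s₀ s :=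
  tsum_nonneg fun t => mul_nonneg (pow_nonneg M.γ_pos.le t) (M.stateProb_nonneg π s₀ t s)

theorem green_eq_add_green_trans (M : FiniteMDP S A) (π : Policy S A) (s₀ s : S) :
    M.green π s₀ s
      = (if s = s₀ then 1 else 0) + M.γ * ∑ s', M.green π s₀ s' * M.trans π s' s := by
  rw [green, (M.summable_stateProb π s₀ s).tsum_eq_zero_add]
  congr 1
  · simp [stateProb]
  · simp only [green, ← tsum_mul_right]
    rw [← Summable.tsum_finsetSum fun s' _ => (M.summable_stateProb π s₀ s').mul_right _,
      ← tsum_mul_left]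
    refine tsum_congr fun t => ?_
    rw [stateProb_succ, Finset.mul_sum, Finset.mul_sum]
    exact Finset.sum_congr rfl fun s' _ => by ring

/-- Conditioning on the first transition instead of the last; this is the form behind the Bellman
equation. -/
theorem green_eq_add_trans_green (M : FiniteMDP S A) (π : Policy S A) (s₀ s : S) :
    M.green π s₀ s
      = (if s = s₀ then 1 else 0) + M.γ * ∑ s', M.trans π s₀ s' * M.green π s' s := by
  rw [green, (M.summable_stateProb π s₀ s).tsum_eq_zero_add]
  congr 1
  · simp [stateProb]
  · simp only [green, ← tsum_mul_left]
    rw [← Summable.tsum_finsetSum fun s' _ => (M.summable_stateProb π s' s).mul_left _,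
      ← tsum_mul_left]
    refine tsum_congr fun t => ?_
    rw [stateProb_succ', Finset.mul_sum, Finset.mul_sum]
    exact Finset.sum_congr rfl fun s' _ => by ring

/-- The Green function is the inverse of `1 - γ P_π`. Flow equation, comparison principle and
performance difference all follow from this. -/
theorem sum_green_mul_sub (M : FiniteMDP S A) (π : Policy S A) (v : S → ℝ) (s₀ : S) :
    ∑ s, M.green π s₀ s * (v s - M.γ * ∑ s', M.trans π s s' * v s') = v s₀ := by
  have h : ∑ s, M.green π s₀ s * v s
      = v s₀ + M.γ * ∑ s, (∑ s', M.green π s₀ s' * M.trans π s' s) * v s := by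
    conv_lhs => enter [2, s]; rw [green_eq_add_green_trans]
    simp [add_mul, Finset.sum_add_distrib, ← Finset.mul_sum, mul_assoc]
  have h2 : ∑ s, (∑ s', M.green π s₀ s' * M.trans π s' s) * v s
      = ∑ s, M.green π s₀ s * ∑ s', M.trans π s s' * v s' := by
    simp only [Finset.sum_mul, Finset.mul_sum]
    rw [Finset.sum_comm]
    simp only [mul_assoc]
  simp only [mul_sub, Finset.sum_sub_distrib]
  rw [h, h2, Finset.mul_sum]
  have : ∀ s, M.green π s₀ s * (M.γ * ∑ s', M.trans π s s' * v s')
      = M.γ * (M.green π s₀ s * ∑ s', M.trans π s s' * v s') := fun s => by ring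
  simp only [this]
  ring

theorem stateVisit_eq (M : FiniteMDP S A) (π : Policy S A) (s : S) :
    M.stateVisit π s = (1 - M.γ) * ∑ s₀, M.ρ s₀ * M.green π s₀ s := by
  simp only [stateVisit, green, Finset.mul_sum]
  exact Finset.sum_congr rfl fun s' _ => by ring

theorem stateActionVisit_eq (M : FiniteMDP S A) (π : Policy S A) (s : S) (a : A) :
    M.stateActionVisit π s a = M.stateVisit π s * π s a := by
  simp only [stateActionVisit, stateVisit_eq, green, stateActionProb, ← mul_assoc, tsum_mul_right,
    ← Finset.sum_mul]

theorem stateVisit_nonneg (M : FiniteMDP S A) (π : Policy S A) (s : S) :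
    0 ≤ M.stateVisit π s := by
  rw [stateVisit_eq]
  exact mul_nonneg M.one_sub_γ_pos.le
    (Finset.sum_nonneg fun s₀ _ => mul_nonneg (M.ρ.2.1 s₀) (M.green_nonneg π s₀ s))

theorem stateValue_eq (M : FiniteMDP S A) (r : S × A → ℝ) (π : Policy S A) (s₀ : S) :
    M.stateValue r π s₀ = ∑ s, M.green π s₀ s * ∑ a, π s a * r (s, a) := by
  simp only [stateValue, green, ← tsum_mul_right]
  rw [← Summable.tsum_finsetSum fun s' _ => (M.summable_stateProb π s₀ s').mul_right _]
  refine tsum_congr fun t => ?_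
  simp only [stateActionProb, Finset.mul_sum, mul_assoc]

/-- Discounted flow equation of the visitation distribution, tested against `v`. -/
theorem sum_stateVisit_mul_sub (M : FiniteMDP S A) (π : Policy S A) (v : S → ℝ) :
    ∑ s, M.stateVisit π s * (v s - M.γ * ∑ s', M.trans π s s' * v s')
      = (1 - M.γ) * ∑ s, M.ρ s * v s := by
  simp only [stateVisit_eq, mul_assoc, ← Finset.mul_sum, Finset.sum_mul]
  rw [Finset.sum_comm]
  simp only [← Finset.mul_sum, sum_green_mul_sub]

theorem sum_stateVisit (M : FiniteMDP S A) (π : Policy S A) : ∑ s, M.stateVisit π s = 1 := by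
  have h := M.sum_stateVisit_mul_sub π fun _ => 1
  simp only [mul_one, sum_trans, ← Finset.sum_mul] at h
  have h1 : ∑ s, M.ρ s = 1 := M.ρ.2.2
  rw [h1, mul_comm] at h
  exact mul_left_cancel₀ M.one_sub_γ_pos.ne' (h.trans rfl)

/-- The value of a state-dependent reward is the visitation average of that reward. -/
theorem sum_ρ_mul_green (M : FiniteMDP S A) (π : Policy S A) (c : S → ℝ) :
    ∑ s₀, M.ρ s₀ * ∑ s, M.green π s₀ s * c s
      = (∑ s, M.stateVisit π s * c s) / (1 - M.γ) := by
  rw [eq_div_iff M.one_sub_γ_pos.ne', mul_comm]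
  simp only [stateVisit_eq, mul_assoc, ← Finset.mul_sum, Finset.sum_mul]
  rw [Finset.sum_comm]
  simp only [Finset.mul_sum]

theorem Reachable.of_stateProb_ne_zero {M : FiniteMDP S A} {π : Policy S A} {s₀ s : S} {t : ℕ}
    (hs : M.Reachable s₀) (h : M.stateProb π s₀ t s ≠ 0) : M.Reachable s := by
  induction t generalizing s with
  | zero =>
    simp only [stateProb, ne_eq, ite_eq_right_iff, one_ne_zero, imp_false, not_not] at h
    exact h ▸ hs
  | succ t ih =>
    rw [stateProb_succ] at h
    obtain ⟨s', -, h'⟩ := Finset.exists_ne_zero_of_sum_ne_zero h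
    exact (ih (left_ne_zero_of_mul h')).of_trans_ne_zero (right_ne_zero_of_mul h')

theorem Reachable.of_green_ne_zero {M : FiniteMDP S A} {π : Policy S A} {s₀ s : S}
    (hs : M.Reachable s₀) (h : M.green π s₀ s ≠ 0) : M.Reachable s := by
  by_contra hn
  have h0 : ∀ t, M.stateProb π s₀ t s = 0 := fun t => by
    by_contra ht
    exact hn (hs.of_stateProb_ne_zero ht)
  simp [green, h0] at h

theorem Reachable.of_stateVisit_ne_zero {M : FiniteMDP S A} {π : Policy S A} {s : S}
    (h : M.stateVisit π s ≠ 0) : M.Reachable s := by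
  rw [stateVisit_eq] at h
  obtain ⟨s₀, -, h₀⟩ := Finset.exists_ne_zero_of_sum_ne_zero (right_ne_zero_of_mul h)
  exact (Reachable.init ((M.ρ.2.1 s₀).lt_of_ne' (left_ne_zero_of_mul h₀))).of_green_ne_zero
    (right_ne_zero_of_mul h₀)

theorem stateVisit_flow (M : FiniteMDP S A) (π : Policy S A) (s : S) :
    M.stateVisit π s = (1 - M.γ) * M.ρ s + M.γ * ∑ s', M.stateVisit π s' * M.trans π s' s := by
  have h := M.sum_stateVisit_mul_sub π (Pi.single s 1)
  simp only [mul_sub, Finset.sum_sub_distrib, Pi.single_apply, mul_ite, mul_one, mul_zero,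
    Finset.sum_ite_eq', Finset.mem_univ, if_true] at h
  rw [← h, Finset.mul_sum]
  have : ∀ s', M.stateVisit π s' * (M.γ * M.trans π s' s)
      = M.γ * (M.stateVisit π s' * M.trans π s' s) := fun s => by ring
  simp only [this]
  ring

/-- By the flow equation, positive visitation propagates along every transition that a full-support
policy can make. With `Reachable.of_stateVisit_ne_zero`, all softmax policies therefore have the
same visited set. -/
theorem Reachable.stateVisit_pos {M : FiniteMDP S A} {π : Policy S A} (hπ : ∀ s a, 0 < π s a)
    {s : S} (hs : M.Reachable s) : 0 < M.stateVisit π s := by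
  have hnn : ∀ s s', 0 ≤ M.stateVisit π s' * M.trans π s' s := fun s s' =>
    mul_nonneg (M.stateVisit_nonneg π s') (M.trans_nonneg π s' s)
  induction hs with
  | @init s h =>
    rw [stateVisit_flow]
    exact add_pos_of_pos_of_nonneg (mul_pos M.one_sub_γ_pos h)
      (mul_nonneg M.γ_pos.le (Finset.sum_nonneg fun s' _ => hnn s s'))
  | @step s a s' _ hP ih =>
    rw [stateVisit_flow]
    refine add_pos_of_nonneg_of_pos (mul_nonneg M.one_sub_γ_pos.le (M.ρ.2.1 s'))
      (mul_pos M.γ_pos (Finset.sum_pos' (fun s _ => hnn s' s) ⟨s, Finset.mem_univ s, mul_pos ih ?_⟩))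
    exact Finset.sum_pos' (fun a _ => mul_nonneg ((π s).2.1 a) ((M.P s a).2.1 s'))
      ⟨a, Finset.mem_univ a, mul_pos (hπ s a) hP⟩

/-- Comparison principle: on reachable states, a larger one-step residual gives a larger value. -/
theorem Reachable.le_of_sub_le {M : FiniteMDP S A} {π : Policy S A} {v w : S → ℝ}
    (h : ∀ s, M.Reachable s → v s - M.γ * ∑ s', M.trans π s s' * v s'
      ≤ w s - M.γ * ∑ s', M.trans π s s' * w s') {s : S} (hs : M.Reachable s) : v s ≤ w s := by
  -- Both values are integrals of their residuals against the Green function, which is nonnegative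
  -- and does not leave the reachable set.
  rw [← M.sum_green_mul_sub π v s, ← M.sum_green_mul_sub π w s]
  refine Finset.sum_le_sum fun s' _ => ?_
  by_cases h0 : M.green π s s' = 0
  · simp [h0]
  · exact mul_le_mul_of_nonneg_left (h s' (hs.of_green_ne_zero h0)) (M.green_nonneg π s s')

end FiniteMDP

/-! ### Relative entropy and the Gibbs identity. -/

theorem klVec_nonneg {ι : Type*} [Fintype ι] (x y : stdSimplex ℝ ι) (hy : ∀ i, 0 < y i) :
    0 ≤ klVec x y := by
  have h : ∑ i, (x i - y i) ≤ klVec x y := by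
    refine Finset.sum_le_sum fun i _ => ?_
    rcases (stdSimplex.zero_le x i).eq_or_lt with h0 | h0
    · rw [← h0]; simp [(hy i).le]
    · have h1 := Real.one_sub_inv_le_log_of_pos (div_pos h0 (hy i))
      have h2 := mul_le_mul_of_nonneg_left h1 h0.le
      rwa [inv_div, mul_sub, mul_one, mul_div_cancel₀ _ h0.ne'] at h2
  rwa [Finset.sum_sub_distrib, stdSimplex.sum_eq_one, stdSimplex.sum_eq_one, sub_self] at h

theorem klVec_self {ι : Type*} [Fintype ι] (x : stdSimplex ℝ ι) : klVec x x = 0 := by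
  refine Finset.sum_eq_zero fun i _ => ?_
  rcases eq_or_ne (x i) 0 with h | h <;> simp [h]

/-- Gibbs variational identity: `y'` is the tilt of `y` by `q / α`, with log-partition `l / α`. -/
theorem sum_mul_sub_klVec {ι : Type*} [Fintype ι] {α l : ℝ} {q : ι → ℝ} {y y' : stdSimplex ℝ ι}
    (hy : ∀ i, 0 < y i) (hy' : ∀ i, 0 < y' i)
    (h : ∀ i, α * Real.log (y' i / y i) = q i - l) (x : stdSimplex ℝ ι) :
    ∑ i, x i * q i - α * klVec x y = l - α * klVec x y' := by
  have h1 : ∀ i, x i * q i - α * (x i * Real.log (x i / y i))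
      = x i * l - α * (x i * Real.log (x i / y' i)) := fun i => by
    rcases eq_or_ne (x i) 0 with h0 | h0
    · simp [h0]
    · have := h i
      rw [Real.log_div (hy' i).ne' (hy i).ne'] at this
      rw [Real.log_div h0 (hy i).ne', Real.log_div h0 (hy' i).ne']
      linear_combination -(x i) * this
  have h2 : ∑ i, x i * l = l := by rw [← Finset.sum_mul, stdSimplex.sum_eq_one, one_mul]
  simp only [klVec, Finset.mul_sum]
  rw [← Finset.sum_sub_distrib, Finset.sum_congr rfl fun i _ => h1 i, Finset.sum_sub_distrib, h2]

/-! ### Regularized Bellman operators and performance difference. -/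

namespace FiniteMDP

variable {S A : Type*} [Fintype S] [Fintype A]

/-- Expected one-step reward with a KL penalty towards `π₀`. -/
def regReward (r : S × A → ℝ) (α : ℝ) (π₀ π : Policy S A) (s : S) : ℝ :=
  ∑ a, π s a * r (s, a) - α * klVec (π s) (π₀ s)

/-- The regularized Bellman operator of the policy `π`. -/
def backup (M : FiniteMDP S A) (r : S × A → ℝ) (α : ℝ) (π₀ π : Policy S A) (v : S → ℝ) (s : S) :
    ℝ :=
  regReward r α π₀ π s + M.γ * ∑ s', M.trans π s s' * v s'

/-- One-step lookahead of a state value. -/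
def lookahead (M : FiniteMDP S A) (r : S × A → ℝ) (v : S → ℝ) (s : S) (a : A) : ℝ :=
  r (s, a) + M.γ * ∑ s', M.P s a s' * v s'

theorem backup_eq (M : FiniteMDP S A) (r : S × A → ℝ) (α : ℝ) (π₀ π : Policy S A) (v : S → ℝ)
    (s : S) :
    M.backup r α π₀ π v s
      = ∑ a, π s a * M.lookahead r v s a - α * klVec (π s) (π₀ s) := by
  simp only [backup, regReward, lookahead, trans, mul_add, Finset.sum_add_distrib, Finset.sum_mul]
  rw [Finset.sum_comm]
  simp only [Finset.mul_sum]
  have : ∀ a s', M.γ * (π s a * M.P s a s' * v s') = π s a * (M.γ * (M.P s a s' * v s')) :=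
    fun a s' => by ring
  simp only [this]
  ring

theorem Reachable.backup_mono {M : FiniteMDP S A} (r : S × A → ℝ) (α : ℝ) (π₀ π : Policy S A)
    {v w : S → ℝ} (h : ∀ s, M.Reachable s → v s ≤ w s) {s : S} (hs : M.Reachable s) :
    M.backup r α π₀ π v s ≤ M.backup r α π₀ π w s :=
  add_le_add_right (mul_le_mul_of_nonneg_left (hs.sum_trans_mono π h) M.γ_pos.le) _

theorem backup_add_const (M : FiniteMDP S A) (r : S × A → ℝ) (α : ℝ) (π₀ π : Policy S A)
    (v : S → ℝ) (c : ℝ) (s : S) :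
    M.backup r α π₀ π (fun s' => v s' + c) s = M.backup r α π₀ π v s + M.γ * c := by
  simp only [backup, mul_add, Finset.sum_add_distrib, ← Finset.sum_mul, sum_trans, one_mul]
  ring

theorem abs_sum_mul_le_norm (r : S × A → ℝ) (π : Policy S A) (s : S) :
    |∑ a, π s a * r (s, a)| ≤ ‖r‖ := by
  calc |∑ a, π s a * r (s, a)| ≤ ∑ a, |π s a * r (s, a)| := Finset.abs_sum_le_sum_abs _ _
    _ ≤ ∑ a, π s a * ‖r‖ := Finset.sum_le_sum fun a _ => by
        rw [abs_mul, abs_of_nonneg (stdSimplex.zero_le (π s) a)]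
        exact mul_le_mul_of_nonneg_left (norm_le_pi_norm r (s, a)) (stdSimplex.zero_le (π s) a)
    _ = ‖r‖ := by rw [← Finset.sum_mul, stdSimplex.sum_eq_one, one_mul]

theorem sum_ρ (M : FiniteMDP S A) : ∑ s, M.ρ s = 1 := M.ρ.2.2

theorem regReward_le {r : S × A → ℝ} {α : ℝ} (hα : 0 ≤ α) {π₀ : Policy S A}
    (hπ₀ : ∀ s a, 0 < π₀ s a) (π : Policy S A) (s : S) : regReward r α π₀ π s ≤ ‖r‖ :=
  (sub_le_self _ (mul_nonneg hα (klVec_nonneg _ _ (hπ₀ s)))).trans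
    (abs_le.1 (abs_sum_mul_le_norm r π s)).2

theorem neg_norm_le_regReward_self (r : S × A → ℝ) (α : ℝ) (π₀ : Policy S A) (s : S) :
    -‖r‖ ≤ regReward r α π₀ π₀ s := by
  rw [regReward, klVec_self, mul_zero, sub_zero]
  exact (abs_le.1 (abs_sum_mul_le_norm r π₀ s)).1

variable [DecidableEq S]

/-- State value of `π` under the reward with a KL penalty towards `π₀`. -/
def regStateValue (M : FiniteMDP S A) (r : S × A → ℝ) (α : ℝ) (π₀ π : Policy S A) (s₀ : S) : ℝ :=
  ∑ s, M.green π s₀ s * regReward r α π₀ π s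

/-- Value of `π` with a KL penalty towards `π₀`. -/
def regPolicyValue (M : FiniteMDP S A) (r : S × A → ℝ) (α : ℝ) (π₀ π : Policy S A) : ℝ :=
  M.value r π - α * (klPolicy (M.stateVisit π) π π₀ / (1 - M.γ))

/-- Bellman equation. -/
theorem backup_regStateValue (M : FiniteMDP S A) (r : S × A → ℝ) (α : ℝ) (π₀ π : Policy S A)
    (s : S) :
    M.backup r α π₀ π (M.regStateValue r α π₀ π) s = M.regStateValue r α π₀ π s := by
  have h : M.regStateValue r α π₀ π s = regReward r α π₀ π s
      + M.γ * ∑ s', (∑ s'', M.trans π s s'' * M.green π s'' s') * regReward r α π₀ π s' := by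
    rw [regStateValue]
    conv_lhs => enter [2, s]; rw [green_eq_add_trans_green]
    simp [add_mul, Finset.sum_add_distrib, ← Finset.mul_sum, mul_assoc]
  rw [h, backup]
  congr 2
  simp only [regStateValue, Finset.sum_mul, Finset.mul_sum]
  rw [Finset.sum_comm]
  simp only [mul_assoc]

theorem regPolicyValue_eq (M : FiniteMDP S A) (r : S × A → ℝ) (α : ℝ) (π₀ π : Policy S A) :
    M.regPolicyValue r α π₀ π = ∑ s, M.ρ s * M.regStateValue r α π₀ π s := by
  simp only [regStateValue, regPolicyValue, value, stateValue_eq, sum_ρ_mul_green, klPolicy,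
    regReward, mul_sub, Finset.sum_sub_distrib]
  have : ∀ s, M.stateVisit π s * (α * klVec (π s) (π₀ s))
      = α * (M.stateVisit π s * klVec (π s) (π₀ s)) := fun s => by ring
  simp only [this, ← Finset.mul_sum, mul_div_assoc]

/-- Performance difference lemma. -/
theorem regPolicyValue_sub (M : FiniteMDP S A) (r : S × A → ℝ) (α : ℝ) (π₀ σ : Policy S A)
    (v : S → ℝ) :
    M.regPolicyValue r α π₀ σ - ∑ s, M.ρ s * v s
      = (∑ s, M.stateVisit σ s * (M.backup r α π₀ σ v s - v s)) / (1 - M.γ) := by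
  have h1 := M.sum_stateVisit_mul_sub σ v
  have h2 : ∑ s, M.stateVisit σ s * (M.backup r α π₀ σ v s - v s)
      = ∑ s, M.stateVisit σ s * regReward r α π₀ σ s
        - ∑ s, M.stateVisit σ s * (v s - M.γ * ∑ s', M.trans σ s s' * v s') := by
    rw [← Finset.sum_sub_distrib]
    exact Finset.sum_congr rfl fun s _ => by rw [backup]; ring
  rw [regPolicyValue_eq]
  simp only [regStateValue, sum_ρ_mul_green]
  rw [h2, h1, sub_div, mul_div_cancel_left₀ _ M.one_sub_γ_pos.ne']

/-- A subsolution of the Bellman equation lies below the value, by the comparison principle; the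
next lemma is the dual for supersolutions. -/
theorem Reachable.le_regStateValue {M : FiniteMDP S A} {r : S × A → ℝ} {α : ℝ}
    {π₀ π : Policy S A} {v : S → ℝ} (h : ∀ s, M.Reachable s → v s ≤ M.backup r α π₀ π v s)
    {s : S} (hs : M.Reachable s) : v s ≤ M.regStateValue r α π₀ π s := by
  refine hs.le_of_sub_le (π := π) fun s hs => ?_
  have h1 := h s hs
  have h2 := M.backup_regStateValue r α π₀ π s
  rw [backup] at h1 h2
  linarith

theorem Reachable.regStateValue_le {M : FiniteMDP S A} {r : S × A → ℝ} {α : ℝ}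
    {π₀ π : Policy S A} {v : S → ℝ} (h : ∀ s, M.Reachable s → M.backup r α π₀ π v s ≤ v s)
    {s : S} (hs : M.Reachable s) : M.regStateValue r α π₀ π s ≤ v s := by
  refine hs.le_of_sub_le (π := π) fun s hs => ?_
  have h1 := h s hs
  have h2 := M.backup_regStateValue r α π₀ π s
  rw [backup] at h1 h2
  linarith

/-! ### Soft policy iteration: improvement, convergence, final estimate. -/

/-- `π'` is the KL-regularized greedy policy of the state value of `π`, at reachable states. -/
def IsSoftGreedy (M : FiniteMDP S A) (r : S × A → ℝ) (α : ℝ) (π₀ π π' : Policy S A) : Prop :=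
  ∀ s, M.Reachable s → ∃ l : ℝ, ∀ a,
    α * Real.log (π' s a / π₀ s a) = M.lookahead r (M.regStateValue r α π₀ π) s a - l

variable {M : FiniteMDP S A} {r : S × A → ℝ} {α : ℝ} {π₀ π π' : Policy S A}

theorem IsSoftGreedy.backup_add_klVec (h : M.IsSoftGreedy r α π₀ π π') (hπ₀ : ∀ s a, 0 < π₀ s a)
    (hπ' : ∀ s a, 0 < π' s a) (σ : Policy S A) {s : S} (hs : M.Reachable s) :
    M.backup r α π₀ σ (M.regStateValue r α π₀ π) s + α * klVec (σ s) (π' s)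
      = M.backup r α π₀ π' (M.regStateValue r α π₀ π) s := by
  obtain ⟨l, hl⟩ := h s hs
  rw [backup_eq, backup_eq, sum_mul_sub_klVec (hπ₀ s) (hπ' s) hl,
    sum_mul_sub_klVec (hπ₀ s) (hπ' s) hl, klVec_self]
  ring

theorem IsSoftGreedy.backup_le (h : M.IsSoftGreedy r α π₀ π π') (hα : 0 ≤ α)
    (hπ₀ : ∀ s a, 0 < π₀ s a) (hπ' : ∀ s a, 0 < π' s a) (σ : Policy S A) {s : S}
    (hs : M.Reachable s) :
    M.backup r α π₀ σ (M.regStateValue r α π₀ π) s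
      ≤ M.backup r α π₀ π' (M.regStateValue r α π₀ π) s := by
  rw [← h.backup_add_klVec hπ₀ hπ' σ hs]
  exact le_add_of_nonneg_right (mul_nonneg hα (klVec_nonneg _ _ (hπ' s)))

/-- Policy improvement: `V_π = T_π V_π ≤ T_π' V_π` makes `V_π` a subsolution for `π'`, so `V_π ≤
V_π'`, and `T_π'` is monotone. -/
theorem IsSoftGreedy.backup_le_regStateValue (h : M.IsSoftGreedy r α π₀ π π') (hα : 0 ≤ α)
    (hπ₀ : ∀ s a, 0 < π₀ s a) (hπ' : ∀ s a, 0 < π' s a) {s : S} (hs : M.Reachable s) :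
    M.backup r α π₀ π' (M.regStateValue r α π₀ π) s ≤ M.regStateValue r α π₀ π' s := by
  rw [← M.backup_regStateValue r α π₀ π' s]
  refine hs.backup_mono r α π₀ π' fun s hs => hs.le_regStateValue fun s hs => ?_
  rw [← M.backup_regStateValue r α π₀ π s]
  exact h.backup_le hα hπ₀ hπ' π hs

theorem regStateValue_le (hα : 0 ≤ α) (hπ₀ : ∀ s a, 0 < π₀ s a) {s : S} (hs : M.Reachable s) :
    M.regStateValue r α π₀ π s ≤ ‖r‖ / (1 - M.γ) := by
  refine hs.regStateValue_le (v := fun _ => ‖r‖ / (1 - M.γ)) fun s _ => ?_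
  rw [backup, ← Finset.sum_mul, sum_trans, one_mul]
  have h := regReward_le (r := r) hα hπ₀ π s
  have h1 := div_mul_cancel₀ ‖r‖ M.one_sub_γ_pos.ne'
  linarith

theorem neg_le_regStateValue_self {s : S} (hs : M.Reachable s) :
    -(‖r‖ / (1 - M.γ)) ≤ M.regStateValue r α π₀ π₀ s := by
  refine hs.le_regStateValue (v := fun _ => -(‖r‖ / (1 - M.γ))) fun s _ => ?_
  rw [backup, ← Finset.sum_mul, sum_trans, one_mul]
  have h := neg_norm_le_regReward_self r α π₀ s
  have h1 := div_mul_cancel₀ ‖r‖ M.one_sub_γ_pos.ne'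
  linarith

/-- Serves the case of zero steps, where the output is the anchor itself: the KL penalty cancels and
only unregularized values remain, each within `‖r‖ / (1 - γ)` of zero. -/
theorem regPolicyValue_add_klPolicy_le (M : FiniteMDP S A) (r : S × A → ℝ) (α : ℝ)
    {π₀ : Policy S A} (hπ₀ : ∀ s a, 0 < π₀ s a) (σ : Policy S A) :
    M.regPolicyValue r α π₀ σ + α * (klPolicy (M.stateVisit σ) σ π₀ / (1 - M.γ))
      ≤ M.regPolicyValue r α π₀ π₀ + 2 * ‖r‖ / (1 - M.γ) := by
  have hρ : ∀ {v w : S → ℝ}, (∀ s, M.Reachable s → v s ≤ w s) →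
      ∑ s, M.ρ s * v s ≤ ∑ s, M.ρ s * w s := fun h => Finset.sum_le_sum fun s _ => by
    rcases (M.ρ.2.1 s).eq_or_lt with h0 | h0
    · change M.ρ s * _ ≤ M.ρ s * _
      rw [show M.ρ s = 0 from h0.symm, zero_mul, zero_mul]
    · exact mul_le_mul_of_nonneg_left (h s (.init h0)) h0.le
  -- Here `le_rfl` makes the regularization weight zero, so the bound concerns the plain value of
  -- `σ`.
  have h1 := hρ fun s hs => regStateValue_le (r := r) (π := σ) le_rfl hπ₀ hs
  have h2 := hρ fun s hs => neg_le_regStateValue_self (r := r) (α := α) (π₀ := π₀) hs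
  rw [← regPolicyValue_eq, ← Finset.sum_mul, sum_ρ, one_mul] at h1 h2
  simp only [regPolicyValue, zero_mul, sub_zero] at h1 h2 ⊢
  rw [mul_div_assoc]
  linarith

/-- Linear convergence of soft policy iteration started at the anchor policy. -/
theorem regStateValue_le_add_pow (hα : 0 ≤ α) {p : ℕ → Policy S A} (hp : ∀ n s a, 0 < p n s a)
    (h : ∀ n, M.IsSoftGreedy r α (p 0) (p n) (p (n + 1))) (σ : Policy S A) (n : ℕ) {s : S}
    (hs : M.Reachable s) :
    M.regStateValue r α (p 0) σ s
      ≤ M.regStateValue r α (p 0) (p n) s + M.γ ^ n * (2 * ‖r‖ / (1 - M.γ)) := by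
  induction n generalizing s with
  | zero =>
    have h1 := regStateValue_le (M := M) (r := r) (π := σ) hα (hp 0) hs
    have h2 := neg_le_regStateValue_self (M := M) (r := r) (α := α) (π₀ := p 0) hs
    rw [pow_zero, one_mul, mul_div_assoc]
    linarith
  | succ n ih =>
    rw [← M.backup_regStateValue r α (p 0) σ s]
    -- With `c` the current error: `T_σ V_σ ≤ T_σ (V_n + c) = T_σ V_n + γ c ≤ V_{n+1} + γ c`. No
    -- optimal policy is needed.
    refine (hs.backup_mono r α (p 0) σ fun s hs => ih hs).trans ?_
    rw [backup_add_const, pow_succ', mul_assoc]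
    gcongr
    exact ((h n).backup_le hα (hp 0) (hp _) σ hs).trans
      ((h n).backup_le_regStateValue hα (hp 0) (hp _) hs)

/-- Greediness is exact for the value of `π`, while the performance difference is taken around the
value of `π'`. Replacing one by the other under `T_σ` costs `γ δ` per state, hence `γ δ / (1 - γ)`
in total. -/
theorem IsSoftGreedy.regPolicyValue_add_le (h : M.IsSoftGreedy r α π₀ π π') (hα : 0 ≤ α)
    (hπ₀ : ∀ s a, 0 < π₀ s a) (hπ' : ∀ s a, 0 < π' s a) {δ : ℝ}
    (hδ : ∀ s, M.Reachable s → M.regStateValue r α π₀ π' s ≤ M.regStateValue r α π₀ π s + δ)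
    (σ : Policy S A) :
    M.regPolicyValue r α π₀ σ + α * (klPolicy (M.stateVisit σ) σ π' / (1 - M.γ))
      ≤ M.regPolicyValue r α π₀ π' + M.γ * δ / (1 - M.γ) := by
  have key : ∑ s, M.stateVisit σ s * (M.backup r α π₀ σ (M.regStateValue r α π₀ π') s
        - M.regStateValue r α π₀ π' s)
      ≤ ∑ s, M.stateVisit σ s * (M.γ * δ - α * klVec (σ s) (π' s)) := by
    refine Finset.sum_le_sum fun s _ => ?_
    by_cases h0 : M.stateVisit σ s = 0
    · simp [h0]
    have hs := Reachable.of_stateVisit_ne_zero h0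
    refine mul_le_mul_of_nonneg_left ?_ (M.stateVisit_nonneg σ s)
    have h1 := hs.backup_mono r α π₀ σ hδ
    rw [backup_add_const] at h1
    have h2 := h.backup_add_klVec hπ₀ hπ' σ hs
    have h3 := h.backup_le_regStateValue hα hπ₀ hπ' hs
    linarith
  have h1 := M.regPolicyValue_sub r α π₀ σ (M.regStateValue r α π₀ π')
  rw [← regPolicyValue_eq] at h1
  have h2 : ∑ s, M.stateVisit σ s * (M.γ * δ - α * klVec (σ s) (π' s))
      = M.γ * δ - α * klPolicy (M.stateVisit σ) σ π' := by
    simp only [mul_sub, Finset.sum_sub_distrib, ← Finset.sum_mul, sum_stateVisit, one_mul,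
      klPolicy, Finset.mul_sum]
    congr 1
    exact Finset.sum_congr rfl fun s _ => by ring
  rw [h2] at key
  have h3 := div_le_div_of_nonneg_right key M.one_sub_γ_pos.le
  rw [← h1, sub_div, mul_div_assoc α] at h3
  linarith

end FiniteMDP

/-! ### Differential calculus of softmax policies. -/

open Asymptotics in
/-- Product rule at a zero of the second factor: the first one only has to be continuous. -/
theorem hasFDerivAt_mul_of_continuousAt {E : Type*} [NormedAddCommGroup E] [NormedSpace ℝ E]
    {f g : E → ℝ} {g' : E →L[ℝ] ℝ} {x : E} (hf : ContinuousAt f x) (hg : HasFDerivAt g g' x)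
    (hx : g x = 0) : HasFDerivAt (fun y => f y * g y) (f x • g') x := by
  rw [hasFDerivAt_iff_isLittleO] at hg ⊢
  have h1 : (fun y => f y * (g y - g x - g' (y - x))) =o[nhds x] fun y => y - x := by
    have := (hf.isBigO_one ℝ).mul_isLittleO hg.norm_right
    simpa using this
  have h2 : (fun y => (f y - f x) * g' (y - x)) =o[nhds x] fun y => y - x := by
    have h3 : (fun y => f y - f x) =o[nhds x] fun _ => (1 : ℝ) := by
      rw [isLittleO_one_iff]
      simpa using hf.sub_const (f x)
    have := h3.mul_isBigO (g'.isBigO_sub (nhds x) x).norm_right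
    simpa using this
  refine (h1.add h2).congr_left fun y => ?_
  simp [hx]
  ring

variable {S A : Type*} [Fintype A] [Nonempty A]

theorem sum_exp_pos (θ : Param S A) (s : S) : 0 < ∑ a, Real.exp (θ (s, a)) :=
  Finset.sum_pos (fun _ _ => Real.exp_pos _) Finset.univ_nonempty

theorem softmax_apply (θ : Param S A) (s : S) (a : A) :
    softmax θ s a = Real.exp (θ (s, a)) / ∑ a', Real.exp (θ (s, a')) := rfl

theorem softmax_pos (θ : Param S A) (s : S) (a : A) : 0 < softmax θ s a :=
  div_pos (Real.exp_pos _) (sum_exp_pos θ s)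

theorem log_softmax (θ : Param S A) (s : S) (a : A) :
    Real.log (softmax θ s a) = θ (s, a) - Real.log (∑ a', Real.exp (θ (s, a'))) := by
  rw [softmax_apply, Real.log_div (Real.exp_pos _).ne' (sum_exp_pos θ s).ne', Real.log_exp]

theorem log_softmax_div (θ θ' : Param S A) (s : S) (a : A) :
    Real.log (softmax θ s a / softmax θ' s a) = θ (s, a) - θ' (s, a)
      - (Real.log (∑ a', Real.exp (θ (s, a'))) - Real.log (∑ a', Real.exp (θ' (s, a')))) := by
  rw [Real.log_div (softmax_pos θ s a).ne' (softmax_pos θ' s a).ne', log_softmax, log_softmax]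
  ring

/-- The derivative of `log π_θ(a|s)`, as a linear form. -/
def scoreForm (θ : Param S A) (s : S) (a : A) : Param S A →L[ℝ] ℝ :=
  EuclideanSpace.proj (s, a) - ∑ a', softmax θ s a' • EuclideanSpace.proj (s, a')

theorem scoreForm_apply (θ : Param S A) (s : S) (a : A) (x : Param S A) :
    scoreForm θ s a x = x (s, a) - ∑ a', softmax θ s a' * x (s, a') := by
  simp [scoreForm]

theorem sum_softmax_mul_scoreForm (θ : Param S A) (s : S) (x : Param S A) :
    ∑ a, softmax θ s a * scoreForm θ s a x = 0 := by
  simp only [scoreForm_apply, mul_sub, Finset.sum_sub_distrib, ← Finset.sum_mul,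
    stdSimplex.sum_eq_one, one_mul, sub_self]

variable [Fintype S]

theorem hasFDerivAt_log_softmax (θ : Param S A) (s : S) (a : A) :
    HasFDerivAt (fun θ' : Param S A => Real.log (softmax θ' s a)) (scoreForm θ s a) θ := by
  simp only [log_softmax]
  have hp : ∀ a, HasFDerivAt (fun θ' : Param S A => θ' (s, a))
      (EuclideanSpace.proj (s, a) : Param S A →L[ℝ] ℝ) θ := fun a =>
    (EuclideanSpace.proj (s, a) : Param S A →L[ℝ] ℝ).hasFDerivAt
  have hZ := (HasFDerivAt.fun_sum (u := Finset.univ) fun a _ => (hp a).exp).log (sum_exp_pos θ s).ne'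
  refine ((hp a).sub hZ).congr_fderiv ?_
  rw [scoreForm, Finset.smul_sum]
  congr 1
  refine Finset.sum_congr rfl fun a' _ => ?_
  rw [smul_smul, softmax_apply, div_eq_inv_mul]

theorem hasFDerivAt_softmax (θ : Param S A) (s : S) (a : A) :
    HasFDerivAt (fun θ' : Param S A => softmax θ' s a) (softmax θ s a • scoreForm θ s a) θ := by
  have h := (hasFDerivAt_log_softmax θ s a).exp
  simpa only [Real.exp_log (softmax_pos _ s a)] using h

theorem continuous_softmax (s : S) (a : A) : Continuous fun θ : Param S A => softmax θ s a :=
  continuous_iff_continuousAt.2 fun θ => (hasFDerivAt_softmax θ s a).continuousAt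

theorem inner_score (θ : Param S A) (s : S) (a : A) (x : Param S A) :
    inner ℝ (FiniteMDP.score θ s a) x = scoreForm θ s a x := by
  rw [FiniteMDP.score, inner_gradient_left, (hasFDerivAt_log_softmax θ s a).fderiv]

/-! ### Policy gradient, Fisher matrix and the natural gradient step. -/

namespace FiniteMDP

theorem hasFDerivAt_backup (M : FiniteMDP S A) (r : S × A → ℝ) (α : ℝ) (θ₀ θ : Param S A)
    (v : S → ℝ) (s : S) :
    HasFDerivAt (fun θ' : Param S A => M.backup r α (softmax θ₀) (softmax θ') v s)
      (∑ a, (softmax θ s a * (M.lookahead r v s a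
        - α * Real.log (softmax θ s a / softmax θ₀ s a))) • scoreForm θ s a) θ := by
  have e : ∀ θ' : Param S A, M.backup r α (softmax θ₀) (softmax θ') v s
      = ∑ a, softmax θ' s a * (M.lookahead r v s a + α * Real.log (softmax θ₀ s a)
        - α * Real.log (softmax θ' s a)) := fun θ' => by
    rw [backup_eq, klVec, Finset.mul_sum, ← Finset.sum_sub_distrib]
    refine Finset.sum_congr rfl fun a _ => ?_
    rw [Real.log_div (softmax_pos θ' s a).ne' (softmax_pos θ₀ s a).ne']
    ring
  simp only [e]
  have h := HasFDerivAt.fun_sum (u := Finset.univ) fun a _ => (hasFDerivAt_softmax θ s a).mul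
    (((hasFDerivAt_log_softmax θ s a).const_mul α).const_sub
      (M.lookahead r v s a + α * Real.log (softmax θ₀ s a)))
  refine h.congr_fderiv (ContinuousLinearMap.ext fun x => ?_)
  have h0 := sum_softmax_mul_scoreForm θ s x
  simp only [sum_apply, add_apply,
    smul_apply, neg_apply, smul_eq_mul]
  -- The two sides differ by the derivative of `log π_θ` inside the entropy, which contributes `-α`
  -- times the mean score, namely zero.
  rw [← sub_eq_zero, ← Finset.sum_sub_distrib, ← mul_zero (-α), ← h0, Finset.mul_sum]
  refine Finset.sum_congr rfl fun a _ => ?_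
  rw [Real.log_div (softmax_pos θ s a).ne' (softmax_pos θ₀ s a).ne']
  ring

variable [DecidableEq S]

theorem continuous_stateProb (M : FiniteMDP S A) (s₀ : S) (t : ℕ) (s : S) :
    Continuous fun θ : Param S A => M.stateProb (softmax θ) s₀ t s := by
  induction t generalizing s with
  | zero => exact continuous_const
  | succ t ih =>
    simp only [stateProb]
    exact continuous_finsetSum _ fun s' _ => continuous_finsetSum _ fun a _ =>
      ((ih s').mul (continuous_softmax s' a)).mul continuous_const

theorem continuous_green (M : FiniteMDP S A) (s₀ s : S) :
    Continuous fun θ : Param S A => M.green (softmax θ) s₀ s :=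
  continuous_tsum (fun t => continuous_const.mul (M.continuous_stateProb s₀ t s))
    M.summable_γ_pow fun t θ => M.norm_pow_mul_stateProb_le (softmax θ) s₀ t s

theorem continuous_stateVisit (M : FiniteMDP S A) (s : S) :
    Continuous fun θ : Param S A => M.stateVisit (softmax θ) s := by
  simp only [stateVisit_eq]
  exact continuous_const.mul
    (continuous_finsetSum _ fun s₀ _ => continuous_const.mul (M.continuous_green s₀ s))

/-- The advantage function of the regularized problem, up to a function of the state, divided by
`1 - γ`. -/
def npgDirection (M : FiniteMDP S A) (r : S × A → ℝ) (α : ℝ) (θ₀ θ : Param S A) : Param S A :=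
  WithLp.toLp 2 fun p =>
    (M.lookahead r (M.regStateValue r α (softmax θ₀) (softmax θ)) p.1 p.2
      - α * Real.log (softmax θ p.1 p.2 / softmax θ₀ p.1 p.2)) / (1 - M.γ)

/-- Policy gradient theorem for the KL-regularized value. -/
theorem hasFDerivAt_regValue (M : FiniteMDP S A) (r : S × A → ℝ) (α : ℝ) (θ₀ θ : Param S A) :
    HasFDerivAt (M.regValue r α θ₀)
      (∑ s, ∑ a, (M.stateActionVisit (softmax θ) s a * M.npgDirection r α θ₀ θ (s, a)) •
        scoreForm θ s a) θ := by
  -- Freezing `v` at the value for `θ` makes each residual `backup - v` vanish at `θ`. The product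
  -- rule then needs only continuity of the visitation distribution, not its derivative.
  set v := M.regStateValue r α (softmax θ₀) (softmax θ)
  have e : ∀ θ', M.regValue r α θ₀ θ' = ∑ s, M.ρ s * v s + (1 - M.γ)⁻¹ *
      ∑ s, M.stateVisit (softmax θ') s * (M.backup r α (softmax θ₀) (softmax θ') v s - v s) :=
    fun θ' => by
      rw [inv_mul_eq_div, ← M.regPolicyValue_sub, add_sub_cancel]
      rfl
  have h := ((HasFDerivAt.fun_sum (u := Finset.univ) fun s _ =>
    hasFDerivAt_mul_of_continuousAt (M.continuous_stateVisit s).continuousAt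
      ((M.hasFDerivAt_backup r α θ₀ θ v s).sub_const (v s))
      (sub_eq_zero.2 (M.backup_regStateValue r α (softmax θ₀) (softmax θ) s))).const_mul
      (1 - M.γ)⁻¹).const_add (∑ s, M.ρ s * v s)
  refine (h.congr_of_eventuallyEq (Filter.Eventually.of_forall e)).congr_fderiv ?_
  simp only [Finset.smul_sum, smul_smul, stateActionVisit_eq, npgDirection]
  refine Finset.sum_congr rfl fun s _ => Finset.sum_congr rfl fun a _ => ?_
  congr 1
  ring

theorem inner_fisher_mulVec (M : FiniteMDP S A) (θ x y : Param S A) :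
    inner ℝ (WithLp.toLp 2 ((M.fisher θ).mulVec x.ofLp)) y
      = ∑ s, ∑ a, M.stateActionVisit (softmax θ) s a * (scoreForm θ s a x * scoreForm θ s a y) := by
  have h : WithLp.toLp 2 ((M.fisher θ).mulVec x.ofLp)
      = ∑ s, ∑ a, (M.stateActionVisit (softmax θ) s a * scoreForm θ s a x) • score θ s a := by
    ext p
    simp only [fisher, Matrix.sum_mulVec, Matrix.smul_mulVec, Matrix.vecMulVec_mulVec,
      ← inner_score, PiLp.inner_apply]
    simp [dotProduct, mul_comm, mul_left_comm]
  rw [h]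
  simp only [sum_inner, inner_smul_left, inner_score]
  simp [mul_assoc]

/-- The policy gradient pairs `npgDirection` with the scores. Since scores have mean zero at each
state, subtracting the state average of the direction changes nothing, and what remains is the
Fisher form. -/
theorem gradient_regValue (M : FiniteMDP S A) (r : S × A → ℝ) (α : ℝ) (θ₀ θ : Param S A) :
    gradient (M.regValue r α θ₀) θ
      = WithLp.toLp 2 ((M.fisher θ).mulVec (M.npgDirection r α θ₀ θ).ofLp) := by
  refine ext_inner_right ℝ fun y => ?_
  rw [inner_gradient_left, (M.hasFDerivAt_regValue r α θ₀ θ).fderiv, inner_fisher_mulVec]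
  simp only [sum_apply, smul_apply, smul_eq_mul]
  refine Finset.sum_congr rfl fun s _ => ?_
  rw [← sub_eq_zero, ← Finset.sum_sub_distrib]
  set w := M.npgDirection r α θ₀ θ
  have h0 : M.stateVisit (softmax θ) s * (∑ a', softmax θ s a' * w (s, a'))
      * ∑ a, softmax θ s a * scoreForm θ s a y = 0 := by
    rw [sum_softmax_mul_scoreForm, mul_zero]
  rw [← h0, Finset.mul_sum]
  refine Finset.sum_congr rfl fun a _ => ?_
  rw [stateActionVisit_eq, scoreForm_apply θ s a w]
  ring

/-- The quadratic form of the Fisher matrix is a sum of squares weighted by visitation, and these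
weights are positive at reachable states. A kernel vector is thus constant in the action there. -/
theorem Reachable.scoreForm_eq_zero {M : FiniteMDP S A} {θ x : Param S A}
    (hx : (M.fisher θ).mulVec x.ofLp = 0) {s : S} (hs : M.Reachable s) (a : A) :
    scoreForm θ s a x = 0 := by
  have h := M.inner_fisher_mulVec θ x x
  rw [hx, WithLp.toLp_zero, inner_zero_left] at h
  have hnn : ∀ s a, 0 ≤ M.stateActionVisit (softmax θ) s a *
      (scoreForm θ s a x * scoreForm θ s a x) := fun s a => by
    rw [stateActionVisit_eq]
    exact mul_nonneg (mul_nonneg (M.stateVisit_nonneg _ s) (softmax_pos θ s a).le)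
      (mul_self_nonneg _)
  have h1 := (Finset.sum_eq_zero_iff_of_nonneg fun s _ => Finset.sum_nonneg fun a _ => hnn s a).1
    h.symm s (Finset.mem_univ s)
  have h2 := (Finset.sum_eq_zero_iff_of_nonneg fun a _ => hnn s a).1 h1 a (Finset.mem_univ a)
  rw [stateActionVisit_eq] at h2
  have h3 := (mul_pos (hs.stateVisit_pos (softmax_pos θ)) (softmax_pos θ s a)).ne'
  exact mul_self_eq_zero.1 ((mul_eq_zero.1 h2).resolve_left h3)

/-- A natural policy gradient step with `η = (1 - γ) / α` is a soft policy iteration step. -/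
theorem isSoftGreedy_npgStep (M : FiniteMDP S A) (r : S × A → ℝ) {α : ℝ} (hα : 0 < α)
    (θ₀ θ : Param S A) :
    M.IsSoftGreedy r α (softmax θ₀) (softmax θ)
      (softmax (M.npgStep r α ((1 - M.γ) / α) θ₀ θ)) := by
  intro s hs
  set w := M.npgDirection r α θ₀ θ with hw
  set F := M.fisher θ
  set x : Param S A := WithLp.toLp 2 ((pinv F).mulVec (F.mulVec w.ofLp)) with hx
  -- Of the Penrose conditions only `F F† F = F` is needed.
  have h0 : F.mulVec (x - w).ofLp = 0 := by
    rw [WithLp.ofLp_sub, Matrix.mulVec_sub, hx]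
    simp only [Matrix.mulVec_mulVec]
    rw [← Matrix.mul_assoc, (pinv_spec F).mul_mul_self, sub_self]
  have h1 : ∀ a, x (s, a) = w (s, a) + ∑ a', softmax θ s a' * (x - w) (s, a') := fun a => by
    have := hs.scoreForm_eq_zero h0 a
    rw [scoreForm_apply, PiLp.sub_apply] at this
    linarith
  have h2 : ∀ a, M.npgStep r α ((1 - M.γ) / α) θ₀ θ (s, a)
      = θ (s, a) + (1 - M.γ) / α * x (s, a) := fun a => by
    simp only [npgStep, gradient_regValue]
    rfl
  have h3 : ∀ a, (1 - M.γ) * w (s, a)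
      = M.lookahead r (M.regStateValue r α (softmax θ₀) (softmax θ)) s a
        - α * Real.log (softmax θ s a / softmax θ₀ s a) := fun a =>
    mul_div_cancel₀ _ M.one_sub_γ_pos.ne'
  -- The witness collects everything independent of the action: the change of the log-partition
  -- function, scaled by `α`, and the kernel shift, scaled by `α η = 1 - γ`.
  refine ⟨α * (Real.log (∑ a', Real.exp (M.npgStep r α ((1 - M.γ) / α) θ₀ θ (s, a')))
    - Real.log (∑ a', Real.exp (θ (s, a')))) - (1 - M.γ) * ∑ a', softmax θ s a' * (x - w) (s, a'),
    fun a => ?_⟩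
  have e : α * ((1 - M.γ) / α * x (s, a)) = (1 - M.γ) * x (s, a) := by field_simp
  have h4 := h3 a
  rw [h1 a] at e
  rw [log_softmax_div] at h4
  rw [log_softmax_div, h2, h1]
  linear_combination e + h4

end FiniteMDP

/-! ### Numerical consequences of the lower bound on the number of steps. -/

theorem five_mul_le_of_log_le {γ R ε t : ℝ} (hγ : 0 < 1 - γ) (hR : 0 ≤ R) (hε : 0 < ε)
    (ht : R ≠ 0 → 1 / (1 - γ) * Real.log (5 * R / ((1 - γ) ^ 2 * ε)) + 1 ≤ t) :
    5 * R ≤ (1 - γ) ^ 2 * ε * Real.exp ((1 - γ) * (t - 1)) := by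
  rcases hR.eq_or_lt with rfl | hR
  · rw [mul_zero]; positivity
  have h1 : Real.log (5 * R / ((1 - γ) ^ 2 * ε)) ≤ (1 - γ) * (t - 1) := by
    have := ht hR.ne'
    rwa [← le_sub_iff_add_le, one_div, inv_mul_le_iff₀ hγ] at this
  rw [← div_le_iff₀' (by positivity)]
  exact (Real.log_le_iff_le_exp (by positivity)).1 h1

theorem two_mul_div_le_of_log_le_zero {γ R ε : ℝ} (hγ0 : 0 < γ) (hγ : 0 < 1 - γ) (hR : 0 ≤ R)
    (hε : 0 < ε) (ht : R ≠ 0 → 1 / (1 - γ) * Real.log (5 * R / ((1 - γ) ^ 2 * ε)) + 1 ≤ 0) :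
    2 * R / (1 - γ) ≤ ε := by
  have h := five_mul_le_of_log_le hγ hR hε ht
  have h1 : Real.exp ((1 - γ) * (0 - 1)) ≤ 1 := Real.exp_le_one_iff.2 (by linarith)
  have h2 : (1 - γ) ^ 2 * ε * Real.exp ((1 - γ) * (0 - 1)) ≤ (1 - γ) ^ 2 * ε :=
    mul_le_of_le_one_right (by positivity) h1
  -- Zero steps are admissible only if the reward is already small compared with `ε`; one factor `1
  -- - γ` is given away here.
  have h3 : (1 - γ) ^ 2 * ε ≤ (1 - γ) * ε :=
    mul_le_mul_of_nonneg_right (pow_le_of_le_one hγ.le (by linarith) two_ne_zero) hε.le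
  rw [div_le_iff₀ hγ]
  linarith

theorem pow_mul_div_le_of_log_le {γ R ε : ℝ} {n : ℕ} (hγ0 : 0 < γ) (hγ : 0 < 1 - γ) (hR : 0 ≤ R)
    (hε : 0 < ε)
    (ht : R ≠ 0 → 1 / (1 - γ) * Real.log (5 * R / ((1 - γ) ^ 2 * ε)) + 1 ≤ ((n + 1 : ℕ) : ℝ)) :
    γ * (γ ^ n * (2 * R / (1 - γ))) / (1 - γ) ≤ ε := by
  have h := five_mul_le_of_log_le hγ hR hε ht
  -- The `+ 1` in the step bound leaves the exponent `n = t - 1`, and `γ exp (1 - γ) ≤ 1` turns the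
  -- exponential into geometric decay. The constant 5 leaves slack, as 2 would suffice.
  have h1 : γ ^ n * Real.exp ((1 - γ) * (((n + 1 : ℕ) : ℝ) - 1)) ≤ 1 := by
    have h2 : γ * Real.exp (1 - γ) ≤ 1 := by
      have h3 := Real.add_one_le_exp (γ - 1)
      calc γ * Real.exp (1 - γ) ≤ Real.exp (γ - 1) * Real.exp (1 - γ) := by gcongr; linarith
        _ = 1 := by rw [← Real.exp_add]; simp
    rw [Nat.cast_succ, add_sub_cancel_right, mul_comm (1 - γ), Real.exp_nat_mul, ← mul_pow]
    exact pow_le_one₀ (by positivity) h2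
  have h2 : γ ^ n * (5 * R) ≤ (1 - γ) ^ 2 * ε := by
    calc γ ^ n * (5 * R)
        ≤ γ ^ n * ((1 - γ) ^ 2 * ε * Real.exp ((1 - γ) * (((n + 1 : ℕ) : ℝ) - 1))) := by gcongr
      _ = (1 - γ) ^ 2 * ε * (γ ^ n * Real.exp ((1 - γ) * (((n + 1 : ℕ) : ℝ) - 1))) := by ring
      _ ≤ (1 - γ) ^ 2 * ε := mul_le_of_le_one_right (by positivity) h1
  have h3 : 0 ≤ γ ^ n * R := by positivity
  have h4 : γ * (γ ^ n * R) ≤ γ ^ n * R := mul_le_of_le_one_left h3 (by linarith)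
  calc γ * (γ ^ n * (2 * R / (1 - γ))) / (1 - γ) = 2 * (γ * (γ ^ n * R)) / (1 - γ) ^ 2 := by
        field_simp
    _ ≤ ε := by
        rw [div_le_iff₀ (by positivity)]
        linarith

end

open FiniteMDP in
theorem proposition1 {S A : Type*} [Fintype S] [DecidableEq S] [Fintype A] [Nonempty A]
    (M : FiniteMDP S A) (r : S × A → ℝ) (θ₀ : Param S A) (α η ε : ℝ) (t : ℕ)
    (hα : 0 < α) (hη : η = (1 - M.γ) / α) (hε : 0 < ε)
    (ht : r ≠ 0 →
      1 / (1 - M.γ) * Real.log (5 * ‖r‖ / ((1 - M.γ) ^ 2 * ε)) + 1 ≤ (t : ℝ))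
    (π : Policy S A) :
    M.value r (softmax (M.innerLoop r α η θ₀ t))
        - α * (klPolicy (M.stateVisit (softmax (M.innerLoop r α η θ₀ t)))
            (softmax (M.innerLoop r α η θ₀ t)) (softmax θ₀) / (1 - M.γ))
      ≥ M.value r π
        - α * ((klPolicy (M.stateVisit π) π (softmax θ₀)
            - klPolicy (M.stateVisit π) π (softmax (M.innerLoop r α η θ₀ t))) / (1 - M.γ))
        - ε := by
  subst hη
  set p : ℕ → Policy S A := fun n => softmax (M.innerLoop r α ((1 - M.γ) / α) θ₀ n) with hp
  have hpos : ∀ n s a, 0 < p n s a := fun n => softmax_pos _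
  have hgreedy : ∀ n, M.IsSoftGreedy r α (p 0) (p n) (p (n + 1)) := fun n => by
    simp only [hp, innerLoop, Function.iterate_succ_apply']
    exact M.isSoftGreedy_npgStep r hα θ₀ _
  suffices h : M.regPolicyValue r α (p 0) π
      + α * (klPolicy (M.stateVisit π) π (p t) / (1 - M.γ))
      ≤ M.regPolicyValue r α (p 0) (p t) + ε by
    simp only [regPolicyValue] at h
    rw [ge_iff_le, sub_div, mul_sub]
    change _ ≤ M.value r (p t) - α * (klPolicy (M.stateVisit (p t)) (p t) (p 0) / (1 - M.γ))
    change M.value r π - (α * (klPolicy (M.stateVisit π) π (p 0) / (1 - M.γ))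
      - α * (klPolicy (M.stateVisit π) π (p t) / (1 - M.γ))) - ε ≤ _
    linarith
  have hγ := M.one_sub_γ_pos
  -- Greediness describes a policy only after at least one step, so the anchor itself is treated
  -- separately.
  cases t with
  | zero =>
    exact (M.regPolicyValue_add_klPolicy_le r α (hpos 0) π).trans (by
      gcongr
      exact two_mul_div_le_of_log_le_zero M.γ_pos hγ (norm_nonneg r) hε (by simpa using ht))
  | succ n =>
    -- The increment `δ` of the last step is bounded by applying the convergence estimate at step
    -- `n` to the competitor `p (n + 1)`.
    refine ((hgreedy n).regPolicyValue_add_le hα.le (hpos 0) (hpos _)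
      (fun s hs => regStateValue_le_add_pow hα.le hpos hgreedy (p (n + 1)) n hs) π).trans ?_
    gcongr
    exact pow_mul_div_le_of_log_le M.γ_pos hγ (norm_nonneg r) hε (by simpa using ht)
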